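/- Let $F$ be a field of characteristic $2$ and let $K=F[i]$ be a separable quadratic field extension of $F$ with $i^2+i=\alpha\in F$. For $u,d$ in a field $E$ of characteristic $2$ with $d\neq 0$, let $[u,d)_{2,E}$ denote the quaternion $E$-algebra generated by $y,z$ subject to $y^2+y=u$, $z^2=d$, $zy=(y+1)z$. Let $a,b,c\in F$ with $bi+c\neq 0$, and suppose that the quaternion algebra $Q=[a,bi+c)_{2,K}$ has trivial corestriction to $F$; that is, the $F$-algebra $N_{K/F}(Q)$ of elements of ${}^{\sigma}Q\otimes_K Q$ fixed by the switch map $x\otimes y\mapsto y\otimes x$ (where $\sigma$ is the nontrivial automorphism of $K/F$ and ${}^{\sigma}Q$ is the conjugate algebra) is isomorphic to a matrix algebra over $F$. Then $Q$ is defined over $F$: there is a central simple $F$-algebra $B$ with $Q\cong B\otimes_F K$. Moreover, except when $F$ has exactly two elements and $b=1$ (in which case $x+x^2b=0$ for every $x\in F$), there is $x\in F$ with $x+x^2b\neq 0$ and $Q\cong[a,x+x^2b)_{2,K}$. -/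

import Mathlib

open scoped TensorProduct Quaternion

/-- The symbol `[a, d)_{2,R}`: the `R`-algebra generated by `u`, `v` subject to `u² - u = a`,
`v² = d`, `v * u = (1 - u) * v`. In characteristic two these relations read `u² + u = a`, `v² = d`,
`v * u = (u + 1) * v`; over a field of characteristic two it is a quaternion algebra exactly when
`d ≠ 0`. -/
abbrev Symb (R : Type*) [CommRing R] (a d : R) : Type _ := ℍ[R, a, 1, d]

theorem Symb.relations {R : Type*} [CommRing R] [CharP R 2] (a d : R) :
    let u : Symb R a d := ⟨0, 1, 0, 0⟩
    let v : Symb R a d := ⟨0, 0, 1, 0⟩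
    u ^ 2 + u = algebraMap R _ a ∧ v ^ 2 = algebraMap R _ d ∧ v * u = (u + 1) * v := by
  have h2 : (1 : R) + 1 = 0 := CharTwo.add_self_eq_zero 1
  have h3 : (-1 : R) = 1 := by rw [neg_eq_iff_add_eq_zero]; exact h2
  refine ⟨?_, ?_, ?_⟩ <;> ext <;> simp [pow_two, h2, h3, QuaternionAlgebra.algebraMap_eq]

section Corestriction

universe u v w

variable {F : Type u} {K : Type v} [Field F] [Field K] [Algebra F K]

/-- The conjugate `σA` of a `K`-algebra `A` by `σ ∈ Gal(K/F)`: the same ring, with `k : K` acting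
as `σ k` does on `A`. -/
def Conj (_σ : K ≃ₐ[F] K) (A : Type w) : Type w := A

variable (σ : K ≃ₐ[F] K) (A : Type w) [Ring A] [Algebra K A]

instance Conj.instRing : Ring (Conj σ A) := inferInstanceAs (Ring A)

instance Conj.instAlgebra : Algebra K (Conj σ A) := Algebra.compHom A (σ : K →+* K)

/-- The identity of the underlying rings. -/
def Conj.of : A ≃+* Conj σ A := RingEquiv.refl A

variable {σ A} in
theorem Conj.smul_of (k : K) (a : A) : k • Conj.of σ A a = Conj.of σ A (σ k • a) := rfl

variable {σ A} in
theorem Conj.algebraMap_eq (k : K) :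
    algebraMap K (Conj σ A) k = Conj.of σ A (algebraMap K A (σ k)) := rfl

/-- The switch map `x ⊗ y ↦ y ⊗ x` on `σA ⊗ A`, for an involution `σ`. It is a `σ`-semilinear
ring homomorphism, which is expressed as `K`-linearity into the conjugate algebra. -/
noncomputable def switchHom (hσ : ∀ k, σ (σ k) = k) :
    (Conj σ A ⊗[K] A) →ₐ[K] Conj σ (Conj σ A ⊗[K] A) :=
  Algebra.TensorProduct.lift
    { toRingHom := (Conj.of σ (Conj σ A ⊗[K] A)).toRingHom.comp
        ((Algebra.TensorProduct.includeRight : A →ₐ[K] Conj σ A ⊗[K] A).toRingHom.comp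
          (Conj.of σ A).symm.toRingHom)
      commutes' := fun k => by
        change Conj.of σ (Conj σ A ⊗[K] A) ((1 : Conj σ A) ⊗ₜ[K] (algebraMap K A (σ k))) = _
        rw [Conj.algebraMap_eq]
        congr 1
        exact (Algebra.TensorProduct.includeRight : A →ₐ[K] Conj σ A ⊗[K] A).commutes (σ k) }
    { toRingHom := (Conj.of σ (Conj σ A ⊗[K] A)).toRingHom.comp
        ((Algebra.TensorProduct.includeLeft : Conj σ A →ₐ[K] Conj σ A ⊗[K] A).toRingHom.comp
          (Conj.of σ A).toRingHom)
      commutes' := fun k => by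
        change Conj.of σ (Conj σ A ⊗[K] A) ((Conj.of σ A (algebraMap K A k)) ⊗ₜ[K] (1 : A)) = _
        have h : Conj.of σ A (algebraMap K A k) = algebraMap K (Conj σ A) (σ k) := by
          rw [Conj.algebraMap_eq, hσ]
        rw [Conj.algebraMap_eq, h]
        congr 1 }
    (fun x y => by
      change (1 : Conj σ A) ⊗ₜ[K] ((Conj.of σ A).symm x) * (Conj.of σ A y) ⊗ₜ[K] (1 : A) =
        (Conj.of σ A y) ⊗ₜ[K] (1 : A) * (1 : Conj σ A) ⊗ₜ[K] ((Conj.of σ A).symm x)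
      simp [Algebra.TensorProduct.tmul_mul_tmul])

/-- The switch map `x ⊗ y ↦ y ⊗ x` as a ring endomorphism of `σA ⊗ A`. -/
noncomputable def switch (hσ : ∀ k, σ (σ k) = k) : (Conj σ A ⊗[K] A) →+* (Conj σ A ⊗[K] A) :=
  (Conj.of σ (Conj σ A ⊗[K] A)).symm.toRingHom.comp (switchHom σ A hσ).toRingHom

variable {A} in
theorem switch_tmul (hσ : ∀ k, σ (σ k) = k) (x y : A) :
    switch σ A hσ (Conj.of σ A x ⊗ₜ[K] y) = Conj.of σ A y ⊗ₜ[K] x := by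
  change (1 : Conj σ A) ⊗ₜ[K] x * (Conj.of σ A y) ⊗ₜ[K] (1 : A) = _
  simp [Algebra.TensorProduct.tmul_mul_tmul]

variable (F K) in
theorem exists_nontrivial_gal [Algebra.IsQuadraticExtension F K] [Algebra.IsSeparable F K] :
    ∃ σ : K ≃ₐ[F] K, σ ≠ 1 ∧ ∀ k, σ (σ k) = k := by
  have hc : Nat.card (K ≃ₐ[F] K) = 2 := by
    rw [IsGalois.card_aut_eq_finrank, Algebra.IsQuadraticExtension.finrank_eq_two]
  have : Nontrivial (K ≃ₐ[F] K) := by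
    rw [← Finite.one_lt_card_iff_nontrivial, hc]; norm_num
  obtain ⟨σ, h⟩ := exists_ne (1 : K ≃ₐ[F] K)
  refine ⟨σ, h, fun k => ?_⟩
  have h2 : σ ^ 2 = 1 := by rw [← hc]; exact pow_card_eq_one'
  rw [pow_two] at h2
  exact DFunLike.congr_fun h2 k

variable (F K) in
/-- The nontrivial automorphism of a separable quadratic extension. -/
noncomputable def galConj [Algebra.IsQuadraticExtension F K] [Algebra.IsSeparable F K] :
    K ≃ₐ[F] K :=
  (exists_nontrivial_gal F K).choose

variable (F K) in
theorem galConj_ne_one [Algebra.IsQuadraticExtension F K] [Algebra.IsSeparable F K] :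
    galConj F K ≠ 1 :=
  (exists_nontrivial_gal F K).choose_spec.1

theorem galConj_galConj [Algebra.IsQuadraticExtension F K] [Algebra.IsSeparable F K] (k : K) :
    galConj F K (galConj F K k) = k :=
  (exists_nontrivial_gal F K).choose_spec.2 k

instance Conj.instAlgebraBase [Algebra F A] : Algebra F (Conj σ A) := inferInstanceAs (Algebra F A)

instance Conj.instIsScalarTower [Algebra F A] [IsScalarTower F K A] :
    IsScalarTower F K (Conj σ A) :=
  IsScalarTower.of_algebraMap_eq fun r => by
    change algebraMap F A r = algebraMap K A (σ (algebraMap F K r))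
    rw [σ.commutes, ← IsScalarTower.algebraMap_apply]

variable (F K) in
/-- The corestriction (norm) `N_{K/F}(A)` of a `K`-algebra `A` along a separable quadratic
extension `K/F` with nontrivial automorphism `σ`: the `F`-algebra of the elements of
`σA ⊗_K A` that are fixed by the switch map. -/
noncomputable def corestriction [Algebra.IsQuadraticExtension F K] [Algebra.IsSeparable F K]
    [Algebra F A] [IsScalarTower F K A] :
    Subalgebra F (Conj (galConj F K) A ⊗[K] A) where
  carrier := {z | switch (galConj F K) A galConj_galConj z = z}
  mul_mem' := fun {x y} hx hy => by
    simp only [Set.mem_ofPred_eq] at hx hy ⊢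
    rw [map_mul, hx, hy]
  add_mem' := fun {x y} hx hy => by
    simp only [Set.mem_ofPred_eq] at hx hy ⊢
    rw [map_add, hx, hy]
  algebraMap_mem' := fun r => by
    simp only [Set.mem_ofPred_eq]
    have h1 : algebraMap F (Conj (galConj F K) A ⊗[K] A) r =
        Conj.of (galConj F K) A (algebraMap F A r) ⊗ₜ[K] (1 : A) := rfl
    have h2 : Conj.of (galConj F K) A (algebraMap F A r) ⊗ₜ[K] (1 : A) =
        Conj.of (galConj F K) A 1 ⊗ₜ[K] (algebraMap F A r) := by
      have h3 : Conj.of (galConj F K) A (algebraMap F A r) =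
          (algebraMap F K r) • Conj.of (galConj F K) A (1 : A) := by
        rw [Conj.smul_of, AlgEquiv.commutes, IsScalarTower.algebraMap_apply F K A,
          Algebra.algebraMap_eq_smul_one]
      rw [h3, TensorProduct.smul_tmul, ← Algebra.algebraMap_eq_smul_one,
        ← IsScalarTower.algebraMap_apply]
    rw [h1, switch_tmul, ← h2]

end Corestriction

/-- An `F`-algebra is split if it is isomorphic to a matrix algebra over `F`. For central simple
algebras this says that the Brauer class is trivial. -/
def IsSplitAlgebra (F : Type*) [Field F] (C : Type*) [Ring C] [Algebra F C] : Prop :=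
  ∃ n : ℕ, n ≠ 0 ∧ Nonempty (C ≃ₐ[F] Matrix (Fin n) (Fin n) F)

/-- A `K`-algebra `Q` is defined over (descends to) `F` if it is isomorphic to `K ⊗_F B` for a
central simple `F`-algebra `B`. -/
def IsDefinedOver.{u, v, w} (F : Type u) (K : Type v) [Field F] [Field K] [Algebra F K]
    (Q : Type w) [Ring Q] [Algebra K Q] : Prop :=
  ∃ B : CSA.{u, u} F, Nonempty (Q ≃ₐ[K] K ⊗[F] B)

/-! Write `δ = bi + c` and `N = N_{K/F}(δ)`. By the projection formula the corestriction of `[a, δ)`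
has the Brauer class of `[a, N)`, so splitting should give `N = p² + pq + q²a` with `p, q ∈ F`. This
is obtained without Brauer groups: the corestriction embeds in some `M_n(F)` with `n ≤ 4`, an
idempotent cuts out a corner on which `[a, N)` acts in dimension two, and the norm equation is read
off from this action (`exists_eq_norm_of_split_corner`,
`exists_eq_norm_of_isSplitAlgebra_corestriction`).

Since `N = δ(δ + b)`, the equation rearranges to `δ(b + q) = (δ + p)² + (δ + p)q + q²a`. So `δ(b +
q)` is a value of the norm form over `K`, and `[a, δ) ≅ [a, b + q)` with second slot in `F`,
provided `q ≠ b` (`Symb.nonempty_algEquiv_of_mul_eq_norm`). If also `q ≠ 0`, dividing the slot by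
the norm `q²` gives `x + x²b` with `x = q⁻¹`. The freedom in `(p, q)` secures both conditions
outside the exceptional case (`exists_eq_norm_ne`). If `X² + X + a` has a root in `K`, all symbols
`[a, ·)` over `K` are isomorphic and nothing else is needed. -/

namespace Symb

/-! ### Isomorphisms between symbols with the same first slot -/

section Isomorphisms

variable {R : Type*} [CommRing R] [CharP R 2]

/-- The generators `u` and `(s + q u) v` of `[a, e)` satisfy the relations of `[a, d)` for
`d = e (s² + s q + a q²)`. -/
def twistedBasis (a : R) {d e : R} (s q : R) (h : d = e * (s ^ 2 + s * q + q ^ 2 * a)) :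
    QuaternionAlgebra.Basis (Symb R a e) a 1 d where
  i := ⟨0, 1, 0, 0⟩
  j := ⟨0, 0, s, q⟩
  k := ⟨0, 0, q * a, s + q⟩
  i_mul_i := by ext <;> simp
  j_mul_j := by
    have h2 : (2 : R) = 0 := CharTwo.two_eq_zero
    ext <;> simp <;> grind
  i_mul_j := by ext <;> simp [mul_comm]
  j_mul_i := by
    have h2 : (2 : R) = 0 := CharTwo.two_eq_zero
    ext <;> simp
    grind

theorem nonempty_algEquiv_of_mul_eq_norm {E : Type*} [Field E] [CharP E 2] (a : E) {d e r t : E}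
    (hd : d ≠ 0) (he : e ≠ 0) (h : d * e = r ^ 2 + r * t + t ^ 2 * a) :
    Nonempty (Symb E a d ≃ₐ[E] Symb E a e) := by
  have h2 : (2 : E) = 0 := CharTwo.two_eq_zero
  let f := (twistedBasis (d := d) (e := e) a (r / e) (t / e)
    (by field_simp; linear_combination h)).liftHom
  -- The inverse rescales `v` by `(r/e + (t/e)u)⁻¹`, which is the conjugate `(r + t + tu)/e` divided
  -- by the norm `d/e`.
  let g := (twistedBasis (d := e) (e := d) a ((r + t) / d) (t / d)
    (by field_simp; linear_combination h - (t ^ 2 + r * t) * h2)).liftHom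
  refine ⟨AlgEquiv.ofAlgHom f g ?_ ?_⟩
  · apply QuaternionAlgebra.hom_ext <;> ext <;>
      simp [f, g, twistedBasis, QuaternionAlgebra.Basis.lift] <;> field_simp <;> grind
  · apply QuaternionAlgebra.hom_ext <;> ext <;>
      simp [f, g, twistedBasis, QuaternionAlgebra.Basis.lift] <;> field_simp <;> grind

end Isomorphisms

/-! ### Symbols under extension of scalars -/

section BaseChange

variable {F K : Type*} [Field F] [Field K] [Algebra F K]

/-- The generators of `K ⊗ [a, d)` over an extension `K` of the ground field. -/
noncomputable def baseChangeBasis (K : Type*) [Field K] [Algebra F K] (a d : F) :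
    QuaternionAlgebra.Basis (K ⊗[F] Symb F a d) (algebraMap F K a) 1 (algebraMap F K d) where
  i := 1 ⊗ₜ (QuaternionAlgebra.Basis.self F).i
  j := 1 ⊗ₜ (QuaternionAlgebra.Basis.self F).j
  k := 1 ⊗ₜ (QuaternionAlgebra.Basis.self F).k
  i_mul_i := by
    simp only [Algebra.TensorProduct.tmul_mul_tmul, QuaternionAlgebra.Basis.i_mul_i,
      TensorProduct.tmul_add, algebraMap_smul, one_smul, mul_one, TensorProduct.tmul_smul,
      Algebra.TensorProduct.one_def]
  j_mul_j := by
    simp only [Algebra.TensorProduct.tmul_mul_tmul, QuaternionAlgebra.Basis.j_mul_j,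
      algebraMap_smul, mul_one, TensorProduct.tmul_smul, Algebra.TensorProduct.one_def]
  i_mul_j := by
    simp only [Algebra.TensorProduct.tmul_mul_tmul, QuaternionAlgebra.Basis.i_mul_j, mul_one]
  j_mul_i := by
    simp only [Algebra.TensorProduct.tmul_mul_tmul, QuaternionAlgebra.Basis.j_mul_i, mul_one,
      one_smul, TensorProduct.tmul_sub]

noncomputable def baseChangeEquiv (a d : F) :
    Symb K (algebraMap F K a) (algebraMap F K d) ≃ₐ[K] K ⊗[F] Symb F a d :=
  let b : QuaternionAlgebra.Basis (Symb K (algebraMap F K a) (algebraMap F K d)) a (1 : F) d :=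
    { i := (QuaternionAlgebra.Basis.self K).i
      j := (QuaternionAlgebra.Basis.self K).j
      k := (QuaternionAlgebra.Basis.self K).k
      i_mul_i := by
        rw [← algebraMap_smul K a, QuaternionAlgebra.Basis.i_mul_i, one_smul, one_smul]
      j_mul_j := by rw [← algebraMap_smul K d, QuaternionAlgebra.Basis.j_mul_j]
      i_mul_j := by simp
      j_mul_i := by simp }
  AlgEquiv.ofAlgHom (baseChangeBasis K a d).liftHom
    (Algebra.TensorProduct.lift (Algebra.ofId K _) b.liftHom
      fun k x => Algebra.commutes k (b.liftHom x))
    (by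
      apply Algebra.TensorProduct.ext'
      intro k x
      have hb : ((baseChangeBasis K a d).liftHom.restrictScalars F).comp b.liftHom =
          Algebra.TensorProduct.includeRight := by
        apply QuaternionAlgebra.hom_ext <;>
          simp [b, baseChangeBasis, QuaternionAlgebra.Basis.lift]
      have hx := DFunLike.congr_fun hb x
      simp only [AlgHom.comp_apply, AlgHom.restrictScalars_apply,
        Algebra.TensorProduct.includeRight_apply] at hx
      change (baseChangeBasis K a d).liftHom (algebraMap K _ k * b.liftHom x) = k ⊗ₜ[F] x
      rw [map_mul, hx, AlgHom.commutes, Algebra.TensorProduct.algebraMap_apply,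
        Algebra.TensorProduct.tmul_mul_tmul, one_mul, mul_one, Algebra.algebraMap_self,
        RingHom.id_apply])
    (by
      apply QuaternionAlgebra.hom_ext <;>
        simp [b, baseChangeBasis, QuaternionAlgebra.Basis.lift])

end BaseChange

/-! ### Symbols are central simple -/

section CentralSimple

variable {F : Type*} [Field F] [CharP F 2]

theorem isCentral (a : F) {d : F} (hd : d ≠ 0) : Algebra.IsCentral F (Symb F a d) where
  out x hx := by
    rw [Subalgebra.mem_center_iff] at hx
    have hu := hx ⟨0, 1, 0, 0⟩
    have hv := hx ⟨0, 0, 1, 0⟩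
    rw [QuaternionAlgebra.ext_iff] at hu hv
    have h2 : (2 : F) = 0 := CharTwo.two_eq_zero
    simp at hu hv
    rw [Algebra.mem_bot]
    refine ⟨x.re, ?_⟩
    ext <;> simp [QuaternionAlgebra.algebraMap_eq] <;> grind

/-- In the decomposition `F[u] ⊕ F[u]v`, the operator `x ↦ x + [u, x]` projects onto `F[u]`. If that
component vanishes, right multiplication by `v` moves `x` into `F[u]`. For `p + qu` in the ideal,
the commutator with `v` is `qv`, and one more factor `v` gives the scalar `qd`. -/
theorem isSimpleRing (a : F) {d : F} (hd : d ≠ 0) : IsSimpleRing (Symb F a d) := by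
  have : Nontrivial (Symb F a d) := ⟨⟨0, 1, fun h => by simpa using congrArg (·.re) h⟩⟩
  have h2 : (2 : F) = 0 := CharTwo.two_eq_zero
  refine .of_eq_bot_or_eq_top fun I => or_iff_not_imp_left.2 fun hI => ?_
  have of_const : ∀ p : F, p ≠ 0 → (⟨p, 0, 0, 0⟩ : Symb F a d) ∈ I → I = ⊤ := fun p hp h => by
    rw [← I.one_mem_iff]
    convert I.mul_mem_left ⟨p⁻¹, 0, 0, 0⟩ _ h using 1
    ext <;> simp [hp]
  have of_field : ∀ p q : F, (p ≠ 0 ∨ q ≠ 0) → (⟨p, q, 0, 0⟩ : Symb F a d) ∈ I → I = ⊤ := by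
    intro p q hpq h
    by_cases hq : q = 0
    · subst hq
      exact of_const p (by simpa using hpq) h
    · refine of_const (q * d) (mul_ne_zero hq hd) ?_
      convert I.mul_mem_right _ (⟨0, 0, 1, 0⟩ : Symb F a d)
        (I.sub_mem (I.mul_mem_left ⟨0, 0, 1, 0⟩ _ h) (I.mul_mem_right _ ⟨0, 0, 1, 0⟩ h)) using 1
      ext <;> simp <;> grind
  obtain ⟨x, hx, hx0⟩ := SetLike.exists_of_lt (bot_lt_iff_ne_bot.mpr hI)
  let u : Symb F a d := ⟨0, 1, 0, 0⟩
  have hc : u * x - x * u ∈ I := I.sub_mem (I.mul_mem_left u _ hx) (I.mul_mem_right _ u hx)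
  by_cases h1 : x.re ≠ 0 ∨ x.imI ≠ 0
  · refine of_field _ _ h1 ?_
    convert I.add_mem hx hc using 1
    ext <;> simp [u] <;> grind
  · push Not at h1
    refine of_field (x.imJ * d) (x.imK * d) ?_ ?_
    · by_contra! h
      apply hx0
      have : x = 0 := by
        ext <;> simp_all
      rw [this]
      exact zero_mem _
    · convert I.mul_mem_right _ (⟨0, 0, 1, 0⟩ : Symb F a d) hx using 1
      ext <;> simp [h1] <;> grind

theorem isDefinedOver {K : Type*} [Field K] [Algebra F K] {Q : Type*} [Ring Q] [Algebra K Q]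
    (a : F) {d : F} (hd : d ≠ 0)
    (h : Nonempty (Q ≃ₐ[K] Symb K (algebraMap F K a) (algebraMap F K d))) :
    IsDefinedOver F K Q := by
  have := isCentral a hd
  have := isSimpleRing a hd
  exact ⟨{ carrier := Symb F a d }, h.map fun e => e.trans (baseChangeEquiv a d)⟩

end CentralSimple

end Symb

/-! ### The norm equation from a split corner -/

/-- Suppose that a matrix algebra of degree at most `4` contains an idempotent `f` exchanged with
`1 + f` by an invertible element `g`, and that the corner cut out by `f` contains generators `J`,
`s` of the symbol `[a, N)`. Then `N` is a norm from the extension by a root of `X² + X + a`. -/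
theorem exists_eq_norm_of_split_corner {F : Type*} [Field F] [CharP F 2] {V : Type*}
    [AddCommGroup V] [Module F V] [FiniteDimensional F V] [Nontrivial V]
    (hV : Module.finrank F V ≤ 4) {a N t : F}
    (ha : ∀ r : F, r ^ 2 + r ≠ a) (ht : t ≠ 0) (f J s g : Module.End F V)
    (hf : f * f = f) (hfJ : f * J = J) (hJ : J * J + J = a • f)
    (hs : s * s = algebraMap F _ N) (hsf : s * f = f * s) (hsJ : s * J = J * s + f * s)
    (hg : g * g = algebraMap F _ t) (hgf : g * f = f * g + g) :
    ∃ p q : F, N = p ^ 2 + p * q + q ^ 2 * a := by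
  have hadd : ∀ x : V, x + x = 0 := fun x => by
    rw [← two_smul F, CharTwo.two_eq_zero, zero_smul]
  have hf' : ∀ x, f (f x) = f x := fun x => LinearMap.congr_fun hf x
  have hfJ' : ∀ x, f (J x) = J x := fun x => LinearMap.congr_fun hfJ x
  have hJ' : ∀ x, J (J x) = a • f x + J x := fun x => by
    have h : J (J x) + J x = a • f x := LinearMap.congr_fun hJ x
    rw [← h, add_assoc, hadd, add_zero]
  have hs' : ∀ x, s (s x) = N • x := fun x => LinearMap.congr_fun hs x
  have hsf' : ∀ x, s (f x) = f (s x) := fun x => LinearMap.congr_fun hsf x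
  have hsJ' : ∀ x, s (J x) = J (s x) + f (s x) := fun x => LinearMap.congr_fun hsJ x
  have hg' : ∀ x, g (g x) = t • x := fun x => LinearMap.congr_fun hg x
  have hgf' : ∀ x, g (f x) = f (g x) + g x := fun x => LinearMap.congr_fun hgf x
  have hg_inj : Function.Injective g := by
    rw [injective_iff_map_eq_zero]
    intro x hx
    have h := hg' x
    rw [hx, map_zero] at h
    exact (smul_eq_zero.1 h.symm).resolve_left ht
  -- Since `gf = (1 + f)g`, the injective map `g` carries the range of `f` into its kernel.
  have hrank : Module.finrank F (LinearMap.range f) ≤ Module.finrank F (LinearMap.ker f) := by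
    refine LinearMap.finrank_le_finrank_of_injective
      (f := g.restrict (p := LinearMap.range f) (q := LinearMap.ker f) ?_) ?_
    · rintro _ ⟨x, rfl⟩
      have h := hgf' (f x)
      rw [hf'] at h
      simpa using h
    · intro x y hxy
      exact Subtype.ext (hg_inj (congrArg Subtype.val hxy))
  have hle : Module.finrank F (LinearMap.range f) ≤ 2 := by
    have := LinearMap.finrank_range_add_finrank_ker f
    omega
  obtain ⟨v, hv0, hfv⟩ : ∃ v, v ≠ 0 ∧ f v = v := by
    by_contra! h
    have hf0 : ∀ x, f x = 0 := fun x => by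
      by_contra hx
      exact h _ hx (hf' x)
    obtain ⟨x, hx⟩ := exists_ne (0 : V)
    have h := hgf' x
    rw [hf0, hf0, map_zero, zero_add] at h
    exact hx (hg_inj (by rw [← h, map_zero]))
  -- An eigenvalue of `J` at `v` would be a root of `X² + X + a` in `F`.
  have hli : LinearIndependent F ![v, J v] := by
    rw [LinearIndependent.pair_iff' hv0]
    intro r hr
    have h := hJ' v
    rw [← hr, map_smul, ← hr, hfv, smul_smul, ← add_smul] at h
    have h' := smul_left_injective F hv0 h
    exact ha r (by linear_combination h' + r * CharTwo.two_eq_zero (R := F))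
  have hspan : Submodule.span F (Set.range ![v, J v]) = LinearMap.range f := by
    apply Submodule.eq_of_le_of_finrank_le
    · rw [Submodule.span_le]
      rintro _ ⟨i, rfl⟩
      fin_cases i
      · exact ⟨v, hfv⟩
      · exact ⟨J v, hfJ' v⟩
    · rw [finrank_span_eq_card hli]
      simpa using hle
  have hsv : s v ∈ Submodule.span F (Set.range ![v, J v]) := by
    rw [hspan]
    exact ⟨s v, by rw [← hsf', hfv]⟩
  rw [Matrix.range_cons_cons_empty, Submodule.mem_span_pair] at hsv
  obtain ⟨p, q, hpq⟩ := hsv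
  refine ⟨p, q, ?_⟩
  -- On the corner `s` is semilinear for `J ↦ J + 1`, so `sv = (p + qJ)v` makes `s²v` the norm of `p
  -- + qJ` times `v`.
  have h := hs' v
  rw [← hpq, map_add, map_smul, map_smul, hsJ', ← hpq] at h
  simp only [map_add, map_smul, hfJ', hJ', hfv] at h
  apply smul_left_injective F hv0
  simp only
  rw [← h]
  have hJJ : ∀ c : F, c • J v + c • J v = 0 := fun c => hadd _
  have e : p • (p • v + q • J v) +
      q • (p • J v + q • (a • v + J v) + (p • v + q • J v)) =
      (p ^ 2 + p * q + q ^ 2 * a) • v + ((p * q) • J v + (p * q) • J v)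
        + ((q * q) • J v + (q * q) • J v) := by module
  rw [e, hJJ, hJJ, add_zero, add_zero]

/-- The relations of `exists_eq_norm_of_split_corner` inside a split subalgebra `C` of a product of
two commuting symbols with generators `y₁, z₁` and `y₂, z₂`. -/
theorem exists_eq_norm_of_split_subalgebra {F T : Type*} [Field F] [CharP F 2] [Ring T]
    [Algebra F T] (C : Subalgebra F T) (hC : Module.finrank F C ≤ 16) (hsplit : IsSplitAlgebra F C)
    {a N t : F} (ha : ∀ r : F, r ^ 2 + r ≠ a) (ht : t ≠ 0)
    {y₁ y₂ z₁ z₂ w₁ w₂ D₁ D₂ E₁ E₂ : T}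
    (hy₁ : y₁ * y₁ = y₁ + algebraMap F T a) (hy₂ : y₂ * y₂ = y₂ + algebraMap F T a)
    (hz₁ : z₁ * z₁ = D₁) (hz₂ : z₂ * z₂ = D₂) (hD : D₁ * D₂ = algebraMap F T N)
    (hw₁ : w₁ * w₁ = E₁) (hw₂ : w₂ * w₂ = E₂) (hE : E₁ + E₂ = algebraMap F T t)
    (hzy₁ : z₁ * y₁ = y₁ * z₁ + z₁) (hzy₂ : z₂ * y₂ = y₂ * z₂ + z₂)
    (hwy₁ : w₁ * y₁ = y₁ * w₁ + w₁) (hwy₂ : w₂ * y₂ = y₂ * w₂ + w₂)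
    (cyy : y₂ * y₁ = y₁ * y₂) (czz : z₂ * z₁ = z₁ * z₂) (cww : w₂ * w₁ = w₁ * w₂)
    (czy₁ : z₂ * y₁ = y₁ * z₂) (czy₂ : z₁ * y₂ = y₂ * z₁)
    (cwy₁ : w₂ * y₁ = y₁ * w₂) (cwy₂ : w₁ * y₂ = y₂ * w₁)
    (hyC : y₁ + y₂ ∈ C) (hyyC : y₁ * y₂ ∈ C) (hzC : z₁ * z₂ ∈ C) (hwC : w₁ + w₂ ∈ C) :
    ∃ p q : F, N = p ^ 2 + p * q + q ^ 2 * a := by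
  obtain ⟨n, hn, ⟨φ⟩⟩ := hsplit
  let Φ : C ≃ₐ[F] Module.End F (Fin n → F) := φ.trans Matrix.toLinAlgEquiv'
  have : Nonempty (Fin n) := ⟨⟨0, Nat.pos_of_ne_zero hn⟩⟩
  have hn4 : n ≤ 4 := by
    have h := φ.toLinearEquiv.finrank_eq
    rw [Module.finrank_matrix, Fintype.card_fin, Module.finrank_self, mul_one] at h
    nlinarith
  have h2 : (2 : T) = 0 := by
    have h := map_ofNat (algebraMap F T) 2
    rw [← h, CharTwo.two_eq_zero, map_zero]
  set A := algebraMap F T a with hA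
  have hA' : ∀ x, A * x = x * A := fun x => Algebra.commutes a x
  -- `y₁` and `y₂` differ by an idempotent because both are roots of `X² + X + a`. On the corner
  -- where they agree, `J = f y₁ = f y₂`, a form that is symmetric and hence available in `C`.
  let f : C := ⟨1 + (y₁ + y₂), C.add_mem C.one_mem hyC⟩
  let J : C := ⟨A + y₁ * y₂, C.add_mem (C.algebraMap_mem a) hyyC⟩
  let s : C := ⟨z₁ * z₂, hzC⟩
  let g : C := ⟨w₁ + w₂, hwC⟩
  refine exists_eq_norm_of_split_corner (V := Fin n → F) (by simpa using hn4) ha ht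
    (Φ f) (Φ J) (Φ s) (Φ g) ?_ ?_ ?_ ?_ ?_ ?_ ?_ ?_
  · rw [← map_mul]
    congr 1
    apply Subtype.ext
    change (1 + (y₁ + y₂)) * (1 + (y₁ + y₂)) = 1 + (y₁ + y₂)
    linear_combination (norm := noncomm_ring) hy₁ + hy₂ + cyy + h2 * (A + y₁ + y₂ + y₁ * y₂)
  · rw [← map_mul]
    congr 1
    apply Subtype.ext
    change (1 + (y₁ + y₂)) * (A + y₁ * y₂) = A + y₁ * y₂
    linear_combination (norm := noncomm_ring)
      hy₁ * y₂ + cyy * y₂ + y₁ * hy₂ - hA' y₂ + h2 * (y₁ * A + A * y₂ + y₁ * y₂)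
  · rw [← map_mul, ← map_add, ← map_smul]
    congr 1
    apply Subtype.ext
    change (A + y₁ * y₂) * (A + y₁ * y₂) + (A + y₁ * y₂) = a • (1 + (y₁ + y₂))
    rw [Algebra.smul_def]
    linear_combination (norm := noncomm_ring) y₁ * cyy * y₂ + hy₁ * y₂ * y₂ + (y₁ + A) * hy₂
      - y₁ * hA' y₂ - hA' y₁ * y₂ - hA' y₁ + h2 * (A * A + A * y₁ * y₂ + y₁ * y₂)
  · rw [← map_mul, ← Φ.commutes]
    congr 1
    apply Subtype.ext
    change z₁ * z₂ * (z₁ * z₂) = algebraMap F T N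
    linear_combination (norm := noncomm_ring) z₁ * czz * z₂ + hz₁ * z₂ * z₂ + D₁ * hz₂ + hD
  · rw [← map_mul, ← map_mul]
    congr 1
    apply Subtype.ext
    change z₁ * z₂ * (1 + (y₁ + y₂)) = (1 + (y₁ + y₂)) * (z₁ * z₂)
    linear_combination (norm := noncomm_ring)
      z₁ * czy₁ + hzy₁ * z₂ + z₁ * hzy₂ + czy₂ * z₂ + h2 * (z₁ * z₂)
  · rw [← map_mul, ← map_mul, ← map_mul, ← map_add]
    congr 1
    apply Subtype.ext
    change z₁ * z₂ * (A + y₁ * y₂) =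
      (A + y₁ * y₂) * (z₁ * z₂) + (1 + (y₁ + y₂)) * (z₁ * z₂)
    linear_combination (norm := noncomm_ring) -z₁ * hA' z₂ - hA' z₁ * z₂ + z₁ * czy₁ * y₂
      + hzy₁ * z₂ * y₂ + (y₁ * z₁ + z₁) * hzy₂ + y₁ * czy₂ * z₂ + czy₂ * z₂
  · rw [← map_mul, ← Φ.commutes]
    congr 1
    apply Subtype.ext
    change (w₁ + w₂) * (w₁ + w₂) = algebraMap F T t
    linear_combination (norm := noncomm_ring) hw₁ + hw₂ + cww + hE + h2 * (w₁ * w₂)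
  · rw [← map_mul, ← map_mul, ← map_add]
    congr 1
    apply Subtype.ext
    change (w₁ + w₂) * (1 + (y₁ + y₂)) = (1 + (y₁ + y₂)) * (w₁ + w₂) + (w₁ + w₂)
    linear_combination (norm := noncomm_ring) hwy₁ + hwy₂ + cwy₁ + cwy₂

/-! ### Application to the corestriction -/

namespace Symb

variable {R : Type*} [CommRing R] (a d k : R)

theorem gen_mul_gen : (⟨0, 1, 0, 0⟩ * ⟨0, 1, 0, 0⟩ : Symb R a d) =
    ⟨0, 1, 0, 0⟩ + algebraMap R _ a := by
  ext <;> simp [QuaternionAlgebra.algebraMap_eq]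

theorem scaled_mul_scaled : (⟨0, 0, k, 0⟩ * ⟨0, 0, k, 0⟩ : Symb R a d) =
    algebraMap R _ (k ^ 2 * d) := by
  rw [QuaternionAlgebra.algebraMap_eq]
  ext <;> simp
  ring

theorem scaled_mul_gen [CharP R 2] : (⟨0, 0, k, 0⟩ * ⟨0, 1, 0, 0⟩ : Symb R a d) =
    ⟨0, 1, 0, 0⟩ * ⟨0, 0, k, 0⟩ + ⟨0, 0, k, 0⟩ := by
  ext <;> simp [CharTwo.neg_eq]

end Symb

section Corestriction

universe u v w

variable {F : Type u} {K : Type v} [Field F] [Field K] [Algebra F K]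

theorem switch_smul (σ : K ≃ₐ[F] K) (A : Type w) [Ring A] [Algebra K A]
    (hσ : ∀ k, σ (σ k) = k) (k : K) (x : Conj σ A ⊗[K] A) :
    switch σ A hσ (k • x) = σ k • switch σ A hσ x :=
  map_smul (switchHom σ A hσ) k x

variable [Algebra.IsQuadraticExtension F K] [Algebra.IsSeparable F K]

theorem galConj_generator [CharP F 2] {α : F} {i : K} (hi : i ^ 2 + i = algebraMap F K α)
    (hK : Algebra.adjoin F {i} = ⊤) : galConj F K i = i + 1 := by
  have : CharP K 2 := charP_of_injective_algebraMap (algebraMap F K).injective 2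
  have h2 : (2 : K) = 0 := CharTwo.two_eq_zero
  have hne : galConj F K i ≠ i := fun h => galConj_ne_one F K <| AlgEquiv.ext fun x => by
    have h' : (galConj F K : K →ₐ[F] K) = AlgHom.id F K :=
      AlgHom.ext_of_adjoin_eq_top hK (by rintro _ rfl; exact h)
    exact DFunLike.congr_fun h' x
  have hi' : galConj F K i ^ 2 + galConj F K i = algebraMap F K α := by
    rw [← map_pow, ← map_add, hi, AlgEquiv.commutes]
  have h : (galConj F K i - i) * (galConj F K i - (i + 1)) = 0 := by
    linear_combination hi' + hi + (algebraMap F K α - galConj F K i * (i + 1)) * h2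
  exact sub_eq_zero.1 ((mul_eq_zero.1 h).resolve_left (sub_ne_zero.2 hne))

/-- The switch is `σ`-semilinear, so if `σ k ≠ k` the fixed space `C` meets `kC` only in `0`. Hence
`2 dim_F C` is at most `dim_F (σA ⊗ A) = 2 (dim_K A)²`. -/
theorem finrank_corestriction_le (A : Type w) [Ring A] [Algebra K A] [Algebra F A]
    [IsScalarTower F K A] [FiniteDimensional K A] :
    Module.finrank F (corestriction F K A) ≤ Module.finrank K A ^ 2 := by
  obtain ⟨k, hk⟩ : ∃ k, galConj F K k ≠ k := by
    by_contra! h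
    exact galConj_ne_one F K (AlgEquiv.ext h)
  have : FiniteDimensional F K := Module.finite_of_finrank_eq_succ
    (Algebra.IsQuadraticExtension.finrank_eq_two F K)
  have : FiniteDimensional F A := FiniteDimensional.trans F K A
  have : FiniteDimensional F (Conj (galConj F K) A) := inferInstanceAs (FiniteDimensional F A)
  have : FiniteDimensional K (Conj (galConj F K) A) := FiniteDimensional.right F K _
  have : FiniteDimensional F (Conj (galConj F K) A ⊗[K] A) := FiniteDimensional.trans F K _
  have hconj : Module.finrank K (Conj (galConj F K) A) = Module.finrank K A := by
    have h1 := Module.finrank_mul_finrank F K A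
    have h2 := Module.finrank_mul_finrank F K (Conj (galConj F K) A)
    have h3 : Module.finrank F (Conj (galConj F K) A) = Module.finrank F A := rfl
    rw [h3, ← h1] at h2
    exact Nat.eq_of_mul_eq_mul_left Module.finrank_pos h2
  let C := (corestriction F K A).toSubmodule
  have hk0 : k ≠ 0 := by
    rintro rfl
    exact hk (map_zero _)
  let m : (Conj (galConj F K) A ⊗[K] A) →ₗ[F] (Conj (galConj F K) A ⊗[K] A) :=
    (LinearMap.lsmul K _ k).restrictScalars F
  have hm : Function.Injective m := smul_right_injective _ hk0
  have hdisj : Disjoint C (C.map m) := by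
    rw [Submodule.disjoint_def]
    rintro _ hx ⟨x, hx', rfl⟩
    have e1 : switch (galConj F K) A galConj_galConj (k • x) = k • x := hx
    have e2 : switch (galConj F K) A galConj_galConj x = x := hx'
    rw [switch_smul, e2, ← sub_eq_zero, ← sub_smul] at e1
    rw [(smul_eq_zero.1 e1).resolve_left (sub_ne_zero.2 hk), map_zero]
  have h := Submodule.finrank_add_finrank_le_of_disjoint hdisj
  rw [← (Submodule.equivMapOfInjective m hm C).finrank_eq, ← Module.finrank_mul_finrank F K (_ ⊗[K] _),
    Algebra.IsQuadraticExtension.finrank_eq_two F K, Module.finrank_tensorProduct, hconj] at h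
  change Module.finrank F C ≤ _
  nlinarith

/-- The scalar `k` provides the invertible element exchanging the two idempotents: for `w = kv`, the
symmetric element `w ⊗ 1 + 1 ⊗ w` has square the trace `t` of `k²δ`. -/
theorem exists_eq_norm_of_isSplitAlgebra_corestriction [CharP F 2] {a N t : F} {δ k : K}
    (hN : algebraMap F K N = galConj F K δ * δ) (ht0 : t ≠ 0)
    (ht : algebraMap F K t = galConj F K (k ^ 2 * δ) + k ^ 2 * δ)
    (ha : ∀ r : F, r ^ 2 + r ≠ a)
    (hcor : IsSplitAlgebra F (corestriction F K (Symb K (algebraMap F K a) δ))) :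
    ∃ p q : F, N = p ^ 2 + p * q + q ^ 2 * a := by
  have : CharP K 2 := charP_of_injective_algebraMap (algebraMap F K).injective 2
  let A := Symb K (algebraMap F K a) δ
  let T := Conj (galConj F K) A ⊗[K] A
  let L : A →+* T := (Algebra.TensorProduct.includeLeft :
    Conj (galConj F K) A →ₐ[K] T).toRingHom.comp (Conj.of (galConj F K) A).toRingHom
  let R : A →+* T := (Algebra.TensorProduct.includeRight : A →ₐ[K] T).toRingHom
  have hLK : ∀ x : K, L (algebraMap K A x) = algebraMap K T (galConj F K x) := fun x => by
    have h : Conj.of (galConj F K) A (algebraMap K A x) =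
        algebraMap K (Conj (galConj F K) A) (galConj F K x) := by
      rw [Conj.algebraMap_eq, galConj_galConj]
    change Conj.of (galConj F K) A (algebraMap K A x) ⊗ₜ[K] (1 : A) = _
    rw [h]
    rfl
  have hRK : ∀ x : K, R (algebraMap K A x) = algebraMap K T x :=
    (Algebra.TensorProduct.includeRight : A →ₐ[K] T).commutes
  have hLF : ∀ x : F, L (algebraMap F A x) = algebraMap F T x := fun x => rfl
  have hRF : ∀ x : F, R (algebraMap F A x) = algebraMap F T x := fun x => by
    rw [IsScalarTower.algebraMap_apply F K A, hRK, ← IsScalarTower.algebraMap_apply]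
  have hLR : ∀ x x' : A, L x * R x' = Conj.of (galConj F K) A x ⊗ₜ[K] x' := fun x x' => by
    change (Conj.of (galConj F K) A x ⊗ₜ[K] (1 : A)) * ((1 : Conj (galConj F K) A) ⊗ₜ[K] x') = _
    rw [Algebra.TensorProduct.tmul_mul_tmul, mul_one, one_mul]
  have hcomm : ∀ x x' : A, R x * L x' = L x' * R x := fun x x' => by
    rw [hLR]
    change ((1 : Conj (galConj F K) A) ⊗ₜ[K] x) * (Conj.of (galConj F K) A x' ⊗ₜ[K] (1 : A)) = _
    rw [Algebra.TensorProduct.tmul_mul_tmul, mul_one, one_mul]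
  have hmul : ∀ x : A, L x * R x ∈ corestriction F K A := fun x => by
    change switch _ _ _ (L x * R x) = L x * R x
    rw [hLR, switch_tmul]
  have hadd : ∀ x : A, L x + R x ∈ corestriction F K A := fun x => by
    change switch _ _ galConj_galConj (L x + R x) = L x + R x
    have h1 : switch (galConj F K) A galConj_galConj (L x) = R x :=
      switch_tmul (galConj F K) galConj_galConj x 1
    have h2 : switch (galConj F K) A galConj_galConj (R x) = L x :=
      switch_tmul (galConj F K) galConj_galConj 1 x
    rw [map_add, h1, h2, add_comm]
  let y : A := ⟨0, 1, 0, 0⟩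
  let z : A := ⟨0, 0, 1, 0⟩
  let w : A := ⟨0, 0, k, 0⟩
  have hy : y * y = y + algebraMap F A a := by
    rw [IsScalarTower.algebraMap_apply F K A]
    exact Symb.gen_mul_gen _ _
  have hz : z * z = algebraMap K A δ :=
    (Symb.scaled_mul_scaled _ _ _).trans (by rw [one_pow, one_mul])
  have hw : w * w = algebraMap K A (k ^ 2 * δ) := Symb.scaled_mul_scaled _ _ _
  have hzy : z * y = y * z + z := Symb.scaled_mul_gen _ _ _
  have hwy : w * y = y * w + w := Symb.scaled_mul_gen _ _ _
  have hC := finrank_corestriction_le (F := F) (K := K) A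
  rw [QuaternionAlgebra.finrank_eq_four] at hC
  refine exists_eq_norm_of_split_subalgebra (corestriction F K A) hC hcor ha ht0
    (y₁ := L y) (y₂ := R y) (z₁ := L z) (z₂ := R z) (w₁ := L w) (w₂ := R w)
    ?_ ?_ ((map_mul L z z).symm.trans ((congrArg L hz).trans (hLK δ)))
    ((map_mul R z z).symm.trans ((congrArg R hz).trans (hRK δ))) ?_
    ((map_mul L w w).symm.trans ((congrArg L hw).trans (hLK _)))
    ((map_mul R w w).symm.trans ((congrArg R hw).trans (hRK _))) ?_
    ?_ ?_ ?_ ?_ (hcomm y y) (hcomm z z) (hcomm w w) (hcomm z y) (hcomm y z).symm (hcomm w y)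
    (hcomm y w).symm (hadd y) (hmul y) (hmul z) (hadd w)
  · rw [← map_mul, hy, map_add, hLF]
  · rw [← map_mul, hy, map_add, hRF]
  · rw [← map_mul, ← hN, ← IsScalarTower.algebraMap_apply]
  · rw [← map_add, ← ht, ← IsScalarTower.algebraMap_apply]
  · rw [← map_mul, hzy, map_add, map_mul]
  · rw [← map_mul, hzy, map_add, map_mul]
  · rw [← map_mul, hwy, map_add, map_mul]
  · rw [← map_mul, hwy, map_add, map_mul]

end Corestriction

/-! ### Choice of the norm representation -/

/-- A value `N = p² + pq + q²a` of the norm form attached to `X² + X + a` can be represented with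
`q` outside `{0, b}`, up to the evident obstructions. -/
theorem exists_eq_norm_ne {F : Type*} [Field F] [CharP F 2] {a b N : F} (hN0 : N ≠ 0)
    (ha : ∀ r : F, r ^ 2 + r ≠ a) (hb : ∀ p : F, b ≠ 0 → N ≠ p ^ 2 + p * b + b ^ 2 * a)
    (hN : ∃ p q : F, N = p ^ 2 + p * q + q ^ 2 * a) :
    ∃ p q : F, N = p ^ 2 + p * q + q ^ 2 * a ∧ q ≠ b ∧ (¬ (Nat.card F = 2 ∧ b = 1) → q ≠ 0) := by
  have h2 : (2 : F) = 0 := CharTwo.two_eq_zero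
  obtain ⟨p, q, hpq⟩ := hN
  by_cases hq : q = 0
  swap
  · exact ⟨p, q, hpq, fun h => hb p (h ▸ hq) (h ▸ hpq), fun _ => hq⟩
  subst hq
  have hp : p ≠ 0 := by
    rintro rfl
    exact hN0 (by simpa using hpq)
  by_cases hexc : Nat.card F = 2 ∧ b = 1
  · exact ⟨p, 0, hpq, by simp [hexc.2], fun h => absurd hexc h⟩
  have hne : ∀ s : F, s ^ 2 + s + a ≠ 0 := fun s hs =>
    ha s (by linear_combination hs - a * h2)
  -- With `θ² + θ = a`, multiply `p` by the norm-one element `(s + θ)²/(s² + s + a)`. The new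
  -- coefficient of `θ` is `p/(s² + s + a)`.
  suffices h : ∃ s : F, p ≠ b * (s ^ 2 + s + a) by
    obtain ⟨s, hs⟩ := h
    have hs0 := hne s
    refine ⟨p * (s ^ 2 + a) / (s ^ 2 + s + a), p / (s ^ 2 + s + a), ?_, ?_, fun _ => ?_⟩
    · rw [div_pow, div_pow, div_mul_div_comm, ← pow_two, div_mul_eq_mul_div, ← add_div, ← add_div,
        eq_div_iff (pow_ne_zero 2 hs0), hpq]
      linear_combination p ^ 2 * (s * (s ^ 2 + a) - a) * h2
    · rwa [ne_eq, div_eq_iff hs0]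
    · exact div_ne_zero hp hs0
  by_contra! h
  have hb0 : b ≠ 0 := by
    rintro rfl
    exact hp (by simpa using h 0)
  -- If every `s` fails then `s² + s` is constant, so `F` has two elements.
  have hF : ∀ t : F, t = 0 ∨ t = 1 := fun t => by
    have h' : b * (t * (t + 1)) = 0 := by linear_combination h 0 - h t
    rcases mul_eq_zero.1 ((mul_eq_zero.1 h').resolve_left hb0) with h' | h'
    · exact .inl h'
    · exact .inr (by linear_combination h' - h2)
  refine hexc ⟨?_, (hF b).resolve_left hb0⟩
  rw [Nat.card_eq_two_iff]
  exact ⟨0, 1, zero_ne_one, Set.eq_univ_of_forall fun t => hF t⟩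

theorem exists_ne_zero_ne {F : Type*} [Field F] {b : F} (h : ¬ (Nat.card F = 2 ∧ b = 1)) :
    ∃ q : F, q ≠ 0 ∧ q ≠ b := by
  by_contra! hF
  have hb : b = 1 := (hF 1 one_ne_zero).symm
  refine h ⟨?_, hb⟩
  rw [Nat.card_eq_two_iff]
  refine ⟨0, 1, zero_ne_one, Set.eq_univ_of_forall fun t => ?_⟩
  by_cases ht : t = 0
  · exact .inl ht
  · exact .inr ((hF t ht).trans hb)

theorem Symb.nonempty_algEquiv_of_eq_sq_add_self {E : Type*} [Field E] [CharP E 2] {a d e : E}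
    (ha : ∃ ρ : E, ρ ^ 2 + ρ = a) (hd : d ≠ 0) (he : e ≠ 0) :
    Nonempty (Symb E a d ≃ₐ[E] Symb E a e) := by
  obtain ⟨ρ, rfl⟩ := ha
  have h2 : (2 : E) = 0 := CharTwo.two_eq_zero
  -- The norm form factors as `(r + tρ)(r + t(ρ + 1))`; `r` and `t` make the factors `de` and `1`.
  refine nonempty_algEquiv_of_mul_eq_norm _ (r := d * e + (d * e + 1) * ρ) (t := d * e + 1) hd he ?_
  grind

/-! ### Descent of the symbol -/

theorem lemma5p1 {F K : Type*} [Field F] [CharP F 2] [Field K] [Algebra F K]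
    [Algebra.IsQuadraticExtension F K] [Algebra.IsSeparable F K]
    (α : F) (i : K) (hi : i ^ 2 + i = algebraMap F K α) (hK : Algebra.adjoin F {i} = ⊤)
    (a b c : F) (hd : algebraMap F K b * i + algebraMap F K c ≠ 0)
    (hcor : IsSplitAlgebra F (corestriction F K
      (Symb K (algebraMap F K a) (algebraMap F K b * i + algebraMap F K c)))) :
    IsDefinedOver F K (Symb K (algebraMap F K a) (algebraMap F K b * i + algebraMap F K c)) ∧
    (¬ (Nat.card F = 2 ∧ b = 1) →
      ∃ x : F, x + x ^ 2 * b ≠ 0 ∧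
        Nonempty (Symb K (algebraMap F K a) (algebraMap F K b * i + algebraMap F K c) ≃ₐ[K]
          Symb K (algebraMap F K a) (algebraMap F K (x + x ^ 2 * b)))) := by
  have : CharP K 2 := charP_of_injective_algebraMap (algebraMap F K).injective 2
  have h2F : (2 : F) = 0 := CharTwo.two_eq_zero
  have h2 : (2 : K) = 0 := CharTwo.two_eq_zero
  have hσ := galConj_generator hi hK
  have hinv : ∀ q : F, q ≠ 0 → q⁻¹ + q⁻¹ ^ 2 * b = (b + q) / q ^ 2 := fun q hq => by
    field_simp
    ring
  have hbq : ∀ q : F, q ≠ b → b + q ≠ 0 := fun q hq h => hq (by linear_combination h - b * h2F)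
  have map_ne : ∀ x : F, x ≠ 0 → algebraMap F K x ≠ 0 := fun x hx => by simpa using hx
  by_cases hsplit : ∃ ρ : K, ρ ^ 2 + ρ = algebraMap F K a
  · refine ⟨Symb.isDefinedOver a (one_ne_zero (α := F))
      (Symb.nonempty_algEquiv_of_eq_sq_add_self hsplit hd (map_ne _ one_ne_zero)),
      fun hexc => ?_⟩
    obtain ⟨q, hq0, hqb⟩ := exists_ne_zero_ne hexc
    have hx : q⁻¹ + q⁻¹ ^ 2 * b ≠ 0 := by
      rw [hinv q hq0]
      exact div_ne_zero (hbq q hqb) (pow_ne_zero 2 hq0)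
    exact ⟨q⁻¹, hx, Symb.nonempty_algEquiv_of_eq_sq_add_self hsplit hd (map_ne _ hx)⟩
  push Not at hsplit
  set B := algebraMap F K b with hB
  set C := algebraMap F K c with hC
  have ha : ∀ r : F, r ^ 2 + r ≠ a := fun r hr =>
    hsplit (algebraMap F K r) (by rw [← hr, map_add, map_pow])
  have hσδ : galConj F K (B * i + C) = B * (i + 1) + C := by
    rw [map_add, map_mul, hσ, hB, hC, AlgEquiv.commutes, AlgEquiv.commutes]
  have hN : algebraMap F K (b ^ 2 * α + b * c + c ^ 2) =
      galConj F K (B * i + C) * (B * i + C) := by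
    rw [hσδ]
    simp only [map_add, map_mul, map_pow, ← hi, ← hB, ← hC]
    linear_combination -B * C * i * h2
  have hN0 : b ^ 2 * α + b * c + c ^ 2 ≠ 0 := by
    intro h
    rw [h, map_zero] at hN
    exact mul_ne_zero ((map_ne_zero _).2 hd) hd hN.symm
  have hnorm : ∃ p q : F, b ^ 2 * α + b * c + c ^ 2 = p ^ 2 + p * q + q ^ 2 * a := by
    -- A multiplier `k` with `k²δ` of nonzero trace: `k = 1` has trace `b`; if `b = 0`, `k = i` has
    -- trace `c`.
    by_cases hb : b = 0
    · have hB0 : B = 0 := by rw [hB, hb, map_zero]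
      have hc : c ≠ 0 := by
        rintro rfl
        exact hd (by rw [hB0, hC, map_zero, zero_mul, zero_add])
      refine exists_eq_norm_of_isSplitAlgebra_corestriction hN hc (k := i) ?_ ha hcor
      rw [map_mul, map_pow, hσδ, hσ, hB0]
      linear_combination -C * (i ^ 2 + i) * h2
    · refine exists_eq_norm_of_isSplitAlgebra_corestriction hN hb (k := 1) ?_ ha hcor
      rw [one_pow, one_mul, hσδ]
      linear_combination -(B * i + C) * h2
  -- The value `q = b ≠ 0` would make `i + (p + c)/b` a root of `X² + X + a` in `K`.
  have hb : ∀ p : F, b ≠ 0 → b ^ 2 * α + b * c + c ^ 2 ≠ p ^ 2 + p * b + b ^ 2 * a := by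
    intro p hb h
    apply hsplit (i + algebraMap F K ((p + c) / b))
    have h' : a = α + ((p + c) / b) ^ 2 + (p + c) / b := by
      field_simp
      grind
    rw [h']
    simp only [map_add, map_pow, ← hi]
    linear_combination i * algebraMap F K ((p + c) / b) * h2
  obtain ⟨p, q, hpq, hqb, hq0⟩ := exists_eq_norm_ne hN0 ha hb hnorm
  have hpq' : (B * (i + 1) + C) * (B * i + C) = algebraMap F K p ^ 2 +
      algebraMap F K p * algebraMap F K q + algebraMap F K q ^ 2 * algebraMap F K a := by
    rw [← hσδ, ← hN, hpq]
    simp only [map_add, map_mul, map_pow]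
  have key : (B * i + C) * (B + algebraMap F K q) =
      (B * i + C + algebraMap F K p) ^ 2 + (B * i + C + algebraMap F K p) * algebraMap F K q +
        algebraMap F K q ^ 2 * algebraMap F K a := by
    linear_combination hpq' - (B * i + C) * (B * i + C + algebraMap F K p) * h2
  have hiso : ∀ l : F, l ≠ 0 → Nonempty (Symb K (algebraMap F K a) (B * i + C) ≃ₐ[K]
      Symb K (algebraMap F K a) (algebraMap F K ((b + q) / l ^ 2))) := fun l hl => by
    have hl' := map_ne l hl
    refine Symb.nonempty_algEquiv_of_mul_eq_norm _
      (r := (B * i + C + algebraMap F K p) / algebraMap F K l)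
      (t := algebraMap F K q / algebraMap F K l) hd
      (map_ne _ (div_ne_zero (hbq q hqb) (pow_ne_zero 2 hl))) ?_
    rw [map_div₀, map_add, map_pow, ← hB]
    field_simp
    linear_combination key
  -- Descent takes `l = 1`, needing only `q ≠ b`, and so covers the exceptional case, where `q` may
  -- be `0`.
  refine ⟨Symb.isDefinedOver a (div_ne_zero (hbq q hqb) (pow_ne_zero 2 one_ne_zero))
    (hiso 1 one_ne_zero), fun hexc => ⟨q⁻¹, ?_, ?_⟩⟩
  · rw [hinv q (hq0 hexc)]
    exact div_ne_zero (hbq q hqb) (pow_ne_zero 2 (hq0 hexc))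
  · rw [hinv q (hq0 hexc)]
    exact hiso q (hq0 hexc)
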